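/- Let $t$ be a power of two (including $t=1$), and let $\mathbf e$ and $\mathbf u$ denote the all-zero and all-one vectors of $\mathbb F_2^{4t}$. A Hadamard code of length $4t$ is a set $C\subseteq\mathbb F_2^{4t}$ containing $\mathbf e$ and consisting of the rows, and the complements of the rows, of a $4t\times 4t$ Hadamard matrix in which $1$ is replaced by $0$ and $-1$ by $1$. A propelinear structure on $C$ assigns to each $x\in C$ a coordinate permutation $\pi_x\in S_{4t}$ such that, for all $x,y\in C$, $x*y:=x+\pi_x(y)\in C$ and $\pi_x\pi_y=\pi_{x*y}$; here $\pi(x)=(x_{\pi^{-1}(1)},\dots,x_{\pi^{-1}(4t)})$. Then $(C,*)$ is a group with identity $\mathbf e$. A Hadamard code $C$ with a propelinear structure is an $\operatorname{HFP}(2t,2,2_{\mathbf u})$-code of length $4t$ if $\pi_{\mathbf e}=\pi_{\mathbf u}=I$, if $\pi_a$ has no fixed coordinate for every $a\in C\setminus\{\mathbf e,\mathbf u\}$, and if there is a group isomorphism $(C,*)\cong C_{2t}\times C_2\times C_2$, with $C_k$ cyclic of order $k$, that takes $\mathbf u$ to the generator of the last factor. If there exists an $\operatorname{HFP}(2t,2,2_{\mathbf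 u})$-code of length $4t$, then $t\in\{1,4\}$. -/

import Mathlib

/-- The `i`-th row of a `±1` matrix `H`, with `1` replaced by `0` and `-1` replaced by `1`. -/
def binaryRow {n : ℕ} (H : Matrix (Fin n) (Fin n) ℤ) (i : Fin n) : Fin n → ZMod 2 :=
  fun j => if H i j = 1 then 0 else 1

/-- The all-one vector `u`. -/
def allOnes (n : ℕ) : Fin n → ZMod 2 := fun _ => 1

/-- A binary Hadamard code of length `n`: the rows of a binary Hadamard matrix together with their
complements. All codes are assumed to contain the all-zero vector. -/
def IsHadamardCode {n : ℕ} (C : Set (Fin n → ZMod 2)) : Prop :=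
  0 ∈ C ∧ ∃ H : Matrix (Fin n) (Fin n) ℤ, H.IsHadamard ∧
    C = {x | ∃ i, x = binaryRow H i ∨ x = binaryRow H i + allOnes n}

/-- The action of a coordinate permutation: `π(x) = (x_{π⁻¹(1)}, …, x_{π⁻¹(n)})`. -/
def permute {n : ℕ} (σ : Equiv.Perm (Fin n)) (x : Fin n → ZMod 2) : Fin n → ZMod 2 :=
  fun i => x (σ⁻¹ i)

/-- A propelinear structure on a binary code `C` (containing the all-zero vector): permutations
`π_x`, for `x ∈ C`, with `x + π_x(y) ∈ C` and `π_x π_y = π_z` for `z = x + π_x(y)`. -/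
structure PropelinearStructure {n : ℕ} (C : Set (Fin n → ZMod 2)) where
  zero_mem : 0 ∈ C
  perm : C → Equiv.Perm (Fin n)
  add_mem : ∀ x y : C, (x : Fin n → ZMod 2) + permute (perm x) y ∈ C
  perm_mul : ∀ x y : C, perm x * perm y = perm ⟨x + permute (perm x) y, add_mem x y⟩

namespace PropelinearStructure

variable {n : ℕ} {C : Set (Fin n → ZMod 2)}

/-- The codewords of `C`, to be equipped with the group operation of the propelinear structure. -/
def Word (_S : PropelinearStructure C) : Type := C

variable (S : PropelinearStructure C)

/-- The propelinear operation `x * y = x + π_x(y)`. -/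
instance : Mul S.Word :=
  ⟨fun x y => ⟨x.1 + permute (S.perm x) y.1, S.add_mem x y⟩⟩

/-- The identity is the all-zero codeword. -/
instance : One S.Word := ⟨⟨0, S.zero_mem⟩⟩

theorem val_mul (x y : S.Word) : (x * y).1 = x.1 + permute (S.perm x) y.1 := rfl

theorem val_one : (1 : S.Word).1 = 0 := rfl

theorem perm_word_mul (x y : S.Word) : S.perm (x * y) = S.perm x * S.perm y :=
  (S.perm_mul x y).symm

theorem inv_mem (x : S.Word) : permute (S.perm x)⁻¹ x.1 ∈ C := by
  have hinj : Function.Injective (fun y : S.Word => x * y) := by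
    intro y z h
    have h1 : (x * y).1 = (x * z).1 := congrArg Subtype.val h
    rw [val_mul, val_mul] at h1
    have h2 := add_left_cancel h1
    apply Subtype.ext
    funext i
    have h3 := congrFun h2 (S.perm x i)
    simpa [permute] using h3
  have : Finite S.Word := inferInstanceAs (Finite C)
  obtain ⟨y, hy⟩ := Finite.surjective_of_injective hinj 1
  have h1 : x.1 + permute (S.perm x) y.1 = 0 := congrArg Subtype.val hy
  have h2 : permute (S.perm x)⁻¹ x.1 = y.1 := by
    funext i
    have h3 := congrFun h1 (S.perm x i)
    simp [permute] at h3
    simp only [permute, inv_inv]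
    rw [← sub_eq_zero, CharTwo.sub_eq_add]
    exact h3
  rw [h2]
  exact y.2

/-- The inverse `x⁻¹ = π_x⁻¹(x)`. -/
instance : Inv S.Word := ⟨fun x => ⟨permute (S.perm x)⁻¹ x.1, S.inv_mem x⟩⟩

/-- The group `(C, *)`. -/
instance : Group S.Word :=
  Group.ofRightAxioms
    (fun x y z => by
      apply Subtype.ext
      rw [val_mul, val_mul, val_mul, val_mul, perm_word_mul]
      funext i
      simp [permute, add_assoc])
    (fun x => by
      apply Subtype.ext
      rw [val_mul, val_one]
      funext i
      simp [permute])
    (fun x => by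
      apply Subtype.ext
      funext i
      change x.1 i + permute (S.perm x) (permute (S.perm x)⁻¹ x.1) i = 0
      simp [permute, CharTwo.add_self_eq_zero])

/-- `C` with the given propelinear structure is a Hadamard full propelinear code: `C` is a Hadamard
code, `π_e = π_u = I`, and `π_a` has no fixed coordinate for every codeword `a ≠ e, u`. -/
def IsHFP : Prop :=
  IsHadamardCode C ∧
    (∀ a : C, a.1 = 0 ∨ a.1 = allOnes n → S.perm a = 1) ∧
    ∀ a : C, a.1 ≠ 0 → a.1 ≠ allOnes n → ∀ i, S.perm a i ≠ i

/-- `C` is an `HFP(m, 2, 2_u)`-code: a Hadamard full propelinear code together with an isomorphism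
of groups `(C, *) ≃ C_m × C_2 × C_2` that takes the codeword `u` to the generator of the last
factor. -/
def IsHFPOfType22u (m : ℕ) : Prop :=
  S.IsHFP ∧
    ∃ φ : S.Word ≃* Multiplicative (ZMod m) × Multiplicative (ZMod 2) × Multiplicative (ZMod 2),
      ∃ u : S.Word, u.1 = allOnes n ∧ φ u = (1, 1, Multiplicative.ofAdd 1)

end PropelinearStructure

/-! The subgroup `G = C_{2t} × C_2` avoiding `u` has order `4t`, and fullness makes it act regularly
on the coordinates. Words other than `0` and `u` are balanced, so reading one coordinate along `G`
gives a perfect `±1` function (`IsHFP.isPerfect`). With `t = 2^m`, the trivial character gives `4t =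
2^(2a)`. A character of order `2^(m+1)` gives `F` in `ℤ[ζ]` with `F * conj F = 2^(2a)`. Since `2` is
totally ramified and its prime is self-conjugate, `2^a ∣ F` (`two_pow_dvd_of_mul_conj_eq`). But `F ≠
0` has coefficients of size at most `4`, so `a ≤ 2` (`IsPerfect.exponent_bound`). -/

open Polynomial in
/-- The ring of integers `ℤ[x]/(x^(2^m) + 1)` of the `2^(m+1)`-th cyclotomic field. -/
abbrev TwoPowCyclotomicRing (m : ℕ) : Type := AdjoinRoot (X ^ 2 ^ m + 1 : ℤ[X])

/-! ### Ramification of `2` in the cyclotomic ring. -/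

namespace TwoPowCyclotomicRing

open Polynomial

variable {m : ℕ}

theorem X_pow_add_one_eq_cyclotomic (m : ℕ) :
    (X ^ 2 ^ m + 1 : ℤ[X]) = cyclotomic (2 ^ (m + 1)) ℤ := by
  rw [cyclotomic_prime_pow_eq_geom_sum Nat.prime_two]
  simp [Finset.sum_range_succ, add_comm]

theorem monic_modulus (m : ℕ) : (X ^ 2 ^ m + 1 : ℤ[X]).Monic := by
  rw [X_pow_add_one_eq_cyclotomic]
  exact cyclotomic.monic _ _

theorem degree_modulus (m : ℕ) : (X ^ 2 ^ m + 1 : ℤ[X]).degree = (2 ^ m : ℕ) := by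
  have h := degree_X_pow_add_C (R := ℤ) (n := 2 ^ m) (by positivity) 1
  simpa using h

instance : IsDomain (TwoPowCyclotomicRing m) := by
  apply AdjoinRoot.isDomain_of_prime
  rw [X_pow_add_one_eq_cyclotomic]
  exact (cyclotomic.irreducible (by positivity)).prime

/-- The distinguished root of unity. -/
noncomputable def zeta (m : ℕ) : TwoPowCyclotomicRing m := AdjoinRoot.root _

theorem zeta_pow : zeta m ^ 2 ^ m = -1 := by
  have h := AdjoinRoot.eval₂_root (X ^ 2 ^ m + 1 : ℤ[X])
  simp only [eval₂_add, eval₂_X_pow, eval₂_one] at h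
  exact eq_neg_of_add_eq_zero_left h

theorem zeta_pow_two_mul : zeta m ^ (2 * 2 ^ m) = 1 := by
  rw [mul_comm, pow_mul, zeta_pow]
  norm_num

/-- Complex conjugation, sending the root of unity to its inverse. -/
noncomputable def conj (m : ℕ) : TwoPowCyclotomicRing m →+* TwoPowCyclotomicRing m :=
  AdjoinRoot.lift (Int.castRingHom _) (zeta m ^ (2 * 2 ^ m - 1)) (by
    simp only [eval₂_add, eval₂_X_pow, eval₂_one]
    rw [← pow_mul, mul_comm, pow_mul, zeta_pow, Odd.neg_one_pow]
    · ring
    · have : 0 < 2 ^ m := by positivity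
      exact ⟨2 ^ m - 1, by omega⟩)

theorem conj_zeta : conj m (zeta m) = zeta m ^ (2 * 2 ^ m - 1) := AdjoinRoot.lift_root _

theorem zeta_mul_conj : zeta m * conj m (zeta m) = 1 := by
  rw [conj_zeta, ← pow_succ', Nat.sub_add_cancel, zeta_pow_two_mul]
  have : 0 < 2 ^ m := by positivity
  omega

theorem conj_conj (F : TwoPowCyclotomicRing m) : conj m (conj m F) = F := by
  have h : (conj m).comp (conj m) = RingHom.id _ := by
    refine AdjoinRoot.ringHom_ext (RingHom.ext_int _ _) ?_
    change conj m (conj m (zeta m)) = zeta m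
    have h1 := congrArg (conj m) (zeta_mul_conj (m := m))
    rw [map_mul, map_one] at h1
    calc _ = zeta m * conj m (zeta m) * conj m (conj m (zeta m)) := by
          rw [zeta_mul_conj, one_mul]
      _ = zeta m := by rw [mul_assoc, h1, mul_one]
  exact DFunLike.congr_fun h F

theorem conj_zeta_pow (k : ℕ) : zeta m ^ k * conj m (zeta m ^ k) = 1 := by
  rw [map_pow, ← mul_pow, zeta_mul_conj, one_pow]

/-- Reduction modulo the prime above `2`. -/
noncomputable def residue (m : ℕ) : TwoPowCyclotomicRing m →+* ZMod 2 :=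
  AdjoinRoot.lift (Int.castRingHom _) 1 (by simp [CharTwo.add_self_eq_zero])

/-- Squaring step: `ζ^(2^i) - 1` divides `ζ^(2^m) - 1 = -2`, hence also `ζ^(2^i) + 1`. -/
theorem zeta_sub_one_pow_dvd (i : ℕ) (hi : i ≤ m) :
    (zeta m - 1) ^ 2 ^ i ∣ zeta m ^ 2 ^ i - 1 := by
  induction i with
  | zero => simp
  | succ i ih =>
    have h2 : zeta m ^ 2 ^ i - 1 ∣ 2 := by
      have h : zeta m ^ 2 ^ i - 1 ∣ zeta m ^ 2 ^ m - 1 := by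
        obtain ⟨j, hj⟩ := pow_dvd_pow 2 (Nat.le_of_succ_le hi)
        have h := sub_one_dvd_pow_sub_one (zeta m ^ 2 ^ i) j
        rwa [← pow_mul, ← hj] at h
      rw [zeta_pow] at h
      rw [← dvd_neg]
      convert h using 1
      norm_num
    have h3 : zeta m ^ 2 ^ i - 1 ∣ zeta m ^ 2 ^ i + 1 := by
      have := dvd_add (dvd_refl (zeta m ^ 2 ^ i - 1)) h2
      convert this using 1
      ring
    have h4 := mul_dvd_mul (ih (Nat.le_of_succ_le hi)) ((ih (Nat.le_of_succ_le hi)).trans h3)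
    convert h4 using 1 <;> ring

theorem zeta_sub_one_pow_dvd_two : (zeta m - 1) ^ 2 ^ m ∣ 2 := by
  have h := zeta_sub_one_pow_dvd m le_rfl
  rw [zeta_pow] at h
  rw [← dvd_neg]
  convert h using 1
  norm_num

/-- Frobenius modulo `2`. With the previous lemma, this is total ramification of `2`. -/
theorem two_dvd_zeta_sub_one_pow : 2 ∣ (zeta m - 1) ^ 2 ^ m := by
  obtain ⟨r, hr⟩ := exists_add_pow_prime_pow_eq Nat.prime_two (zeta m) (-1) m
  rw [sub_eq_add_neg, hr, zeta_pow, Nat.cast_two, mul_assoc, mul_assoc]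
  refine dvd_add ?_ (dvd_mul_right _ _)
  rcases neg_one_pow_eq_or (TwoPowCyclotomicRing m) (2 ^ m) with h | h <;> rw [h] <;> norm_num

theorem zeta_sub_one_dvd_two : zeta m - 1 ∣ 2 :=
  (dvd_pow_self _ (by positivity)).trans zeta_sub_one_pow_dvd_two

/-- Supplies the primality of `ζ - 1`: the quotient embeds in the field `ZMod 2`. -/
theorem zeta_sub_one_dvd_iff (F : TwoPowCyclotomicRing m) :
    zeta m - 1 ∣ F ↔ residue m F = 0 := by
  constructor
  · rintro ⟨G, rfl⟩
    rw [map_mul, map_sub, map_one, zeta, residue, AdjoinRoot.lift_root]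
    simp
  · induction F using AdjoinRoot.induction_on with
    | ih p =>
      intro h
      rw [residue, AdjoinRoot.lift_mk, eval₂_at_one] at h
      have h2 : (2 : ℤ) ∣ p.eval 1 := (ZMod.intCast_zmod_eq_zero_iff_dvd _ 2).mp h
      obtain ⟨q, hq⟩ := X_sub_C_dvd_sub_C_eval (a := (1 : ℤ)) (p := p)
      have h3 := congrArg (AdjoinRoot.mk (X ^ 2 ^ m + 1 : ℤ[X])) (sub_eq_iff_eq_add.mp hq)
      rw [h3, map_add, map_mul]
      refine dvd_add (Dvd.dvd.mul_right ?_ _) (zeta_sub_one_dvd_two.trans ?_)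
      · simp [zeta]
      · obtain ⟨k, hk⟩ := h2
        exact ⟨k, by rw [AdjoinRoot.mk_C, hk, map_mul, map_ofNat, eq_intCast]⟩

theorem associated_conj_zeta_sub_one : Associated (conj m (zeta m - 1)) (zeta m - 1) := by
  have hu : IsUnit (-zeta m) := IsUnit.neg (IsUnit.of_mul_eq_one _ zeta_mul_conj)
  refine ⟨hu.unit, ?_⟩
  have := zeta_mul_conj (m := m)
  rw [IsUnit.unit_spec, map_sub, map_one]
  linear_combination -this

theorem zeta_sub_one_dvd_conj {F : TwoPowCyclotomicRing m} (h : zeta m - 1 ∣ F) :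
    zeta m - 1 ∣ conj m F :=
  associated_conj_zeta_sub_one.symm.dvd.trans (map_dvd (conj m) h)

theorem two_ne_zero' : (2 : TwoPowCyclotomicRing m) ≠ 0 := by
  intro h
  have h2 : AdjoinRoot.mk (X ^ 2 ^ m + 1 : ℤ[X]) (C 2) = 0 := by
    rw [AdjoinRoot.mk_C]
    exact_mod_cast h
  rw [AdjoinRoot.mk_eq_zero] at h2
  have h3 := degree_le_of_dvd h2 (by simp)
  rw [degree_modulus, degree_C (by norm_num)] at h3
  have : (0 : WithBot ℕ) < (2 ^ m : ℕ) := by exact_mod_cast (by positivity : 0 < 2 ^ m)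
  exact absurd h3 (not_le.mpr this)

theorem zeta_sub_one_ne_zero : zeta m - 1 ≠ 0 := by
  intro h
  have h1 := zeta_sub_one_dvd_two (m := m)
  rw [h, zero_dvd_iff] at h1
  exact two_ne_zero' h1

/-- The prime above `2` is self-conjugate, so `F` has half the valuation of `F * conj F`. -/
theorem pow_dvd_of_pow_dvd_mul_conj (i : ℕ) (F : TwoPowCyclotomicRing m)
    (h : (zeta m - 1) ^ (2 * i) ∣ F * conj m F) : (zeta m - 1) ^ i ∣ F := by
  induction i generalizing F with
  | zero => simp
  | succ i ih =>
    have h1 : zeta m - 1 ∣ F * conj m F := (dvd_pow_self _ (by omega)).trans h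
    have h2 : zeta m - 1 ∣ F := by
      rw [zeta_sub_one_dvd_iff, map_mul, mul_eq_zero] at h1
      rcases h1 with h1 | h1
      · exact (zeta_sub_one_dvd_iff F).mpr h1
      · have := zeta_sub_one_dvd_conj ((zeta_sub_one_dvd_iff _).mpr h1)
        rwa [conj_conj] at this
    obtain ⟨G, rfl⟩ := h2
    rw [pow_succ']
    refine mul_dvd_mul_left _ (ih G ?_)
    have h3 : Associated ((zeta m - 1) * G * conj m ((zeta m - 1) * G))
        ((zeta m - 1) ^ 2 * (G * conj m G)) := by
      have := (associated_conj_zeta_sub_one (m := m)).mul_left ((zeta m - 1) * (G * conj m G))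
      rw [map_mul]
      convert this using 1 <;> ring
    have h4 := h.trans h3.dvd
    rw [mul_add, pow_add, mul_comm, mul_one] at h4
    exact (mul_dvd_mul_iff_left (pow_ne_zero 2 zeta_sub_one_ne_zero)).mp h4

theorem two_pow_dvd_of_mul_conj_eq (a : ℕ) (F : TwoPowCyclotomicRing m)
    (h : F * conj m F = 2 ^ (2 * a)) : 2 ^ a ∣ F := by
  have h1 : (zeta m - 1) ^ (2 ^ m * a) ∣ F := by
    apply pow_dvd_of_pow_dvd_mul_conj
    rw [h, show 2 * (2 ^ m * a) = 2 ^ m * (2 * a) by ring, pow_mul]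
    exact pow_dvd_pow_of_dvd zeta_sub_one_pow_dvd_two _
  refine dvd_trans ?_ h1
  rw [pow_mul]
  exact pow_dvd_pow_of_dvd two_dvd_zeta_sub_one_pow _

/-- The `ζ^j` with `j < 2^m` form a `ℤ`-basis, by division by the monic modulus. -/
theorem dvd_coeff_of_dvd_sum (n : ℤ) (b : ℕ → ℤ)
    (h : (n : TwoPowCyclotomicRing m) ∣ ∑ j ∈ Finset.range (2 ^ m), (b j : TwoPowCyclotomicRing m) *
      zeta m ^ j) (j : ℕ) (hj : j < 2 ^ m) : n ∣ b j := by
  obtain ⟨G, hG⟩ := h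
  induction G using AdjoinRoot.induction_on with
  | ih q =>
    set r := q %ₘ (X ^ 2 ^ m + 1 : ℤ[X])
    set p : ℤ[X] := ∑ j ∈ Finset.range (2 ^ m), C (b j) * X ^ j with hp
    have hr : AdjoinRoot.mk (X ^ 2 ^ m + 1 : ℤ[X]) q = AdjoinRoot.mk _ r := by
      rw [AdjoinRoot.mk_eq_mk]
      exact ⟨q /ₘ (X ^ 2 ^ m + 1), by rw [sub_eq_iff_eq_add, add_comm, modByMonic_add_div]⟩
    have hdp : p.degree < (2 ^ m : ℕ) := by
      refine (degree_sum_le _ _).trans_lt ((Finset.sup_lt_iff (WithBot.bot_lt_coe _)).mpr ?_)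
      intro k hk
      refine (degree_C_mul_X_pow_le k (b k)).trans_lt ?_
      exact_mod_cast Finset.mem_range.mp hk
    have hdr : (C n * r).degree < (2 ^ m : ℕ) := by
      rw [← degree_modulus]
      rw [← smul_eq_C_mul]
      exact (degree_smul_le _ _).trans_lt (degree_modByMonic_lt _ (monic_modulus m))
    have hpr : AdjoinRoot.mk (X ^ 2 ^ m + 1 : ℤ[X]) (p - C n * r) = 0 := by
      rw [map_sub, map_mul, ← hr, hp, map_sum, sub_eq_zero]
      simpa [zeta] using hG
    have h0 : p - C n * r = 0 := by
      by_contra hne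
      refine AdjoinRoot.mk_ne_zero_of_degree_lt (monic_modulus m) hne ?_ hpr
      rw [degree_modulus]
      exact (degree_sub_le _ _).trans_lt (max_lt hdp hdr)
    refine ⟨r.coeff j, ?_⟩
    have h1 := congrArg (fun p => coeff p j) (sub_eq_zero.mp h0)
    simpa [hp, coeff_X_pow, hj] using h1

end TwoPowCyclotomicRing

/-! ### Perfect functions and characters. -/

/-- An integer function on a finite group with autocorrelation `n` at the identity and `0`
elsewhere. -/
def IsPerfect {G : Type*} [Group G] [Fintype G] (n : ℤ) (f : G → ℤ) : Prop :=
  ∑ h, f h * f h = n ∧ ∀ g : G, g ≠ 1 → ∑ h, f (h * g) * f h = 0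

/-- With `ψ` the inverse of `χ`, the product is the character sum of the autocorrelation, where only
the identity survives. -/
theorem IsPerfect.sum_mul_sum {G R : Type*} [CommGroup G] [Fintype G] [CommRing R] {n : ℤ}
    {f : G → ℤ} (hf : IsPerfect n f) (χ ψ : G →* R) (hχ : ∀ g, χ g * ψ g = 1) :
    (∑ g, (f g : R) * χ g) * ∑ g, (f g : R) * ψ g = n := by
  classical
  calc (∑ g, (f g : R) * χ g) * ∑ g, (f g : R) * ψ g
      = ∑ h, ∑ g, ((f g : R) * χ g) * ((f h : R) * ψ h) := by
        rw [Finset.sum_mul_sum, Finset.sum_comm]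
    _ = ∑ h, ∑ g, ((f (h * g) : R) * χ (h * g)) * ((f h : R) * ψ h) :=
        Finset.sum_congr rfl fun h _ => (Fintype.sum_equiv (Equiv.mulLeft h) _ _ fun _ => rfl).symm
    _ = ∑ g, ∑ h, ((f (h * g) : R) * χ (h * g)) * ((f h : R) * ψ h) := Finset.sum_comm
    _ = ∑ g, χ g * ((∑ h, f (h * g) * f h : ℤ) : R) := by
        refine Finset.sum_congr rfl fun g _ => ?_
        rw [Int.cast_sum, Finset.mul_sum]
        refine Finset.sum_congr rfl fun h _ => ?_
        rw [map_mul]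
        push_cast
        linear_combination (f (h * g) : R) * χ g * f h * hχ h
    _ = n := by
        rw [Finset.sum_eq_single 1]
        · simp [hf.1]
        · intro g _ hg
          rw [hf.2 g hg, Int.cast_zero, mul_zero]
        · simp

theorem IsPerfect.isSquare {G : Type*} [CommGroup G] [Fintype G] {n : ℤ} {f : G → ℤ}
    (hf : IsPerfect n f) : IsSquare n :=
  ⟨∑ g, f g, by simpa using (hf.sum_mul_sum (1 : G →* ℤ) 1 (by simp)).symm⟩

theorem exists_eq_pow_of_isSquare_two_pow {k : ℕ} (h : IsSquare ((2 : ℤ) ^ k)) :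
    ∃ a, k = 2 * a := by
  obtain ⟨r, hr⟩ := h
  have h1 : r.natAbs * r.natAbs = 2 ^ k := by
    rw [← Int.natAbs_mul, ← hr, Int.natAbs_pow]
    rfl
  obtain ⟨a, -, ha⟩ := (Nat.dvd_prime_pow Nat.prime_two).mp ⟨_, h1.symm⟩
  rw [ha, ← pow_add] at h1
  exact ⟨a, by have := Nat.pow_right_injective le_rfl h1; omega⟩

open TwoPowCyclotomicRing in
/-- Turyn's exponent bound for binary perfect functions on `C_{2^(m+1)} × C_2`. -/
theorem IsPerfect.exponent_bound {m : ℕ}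
    {f : Multiplicative (ZMod (2 ^ (m + 1))) × Multiplicative (ZMod 2) → ℤ}
    (hf : IsPerfect (2 ^ (m + 2)) f) (hsign : ∀ g, |f g| ≤ 1) : m = 0 ∨ m = 2 := by
  obtain ⟨a, ha⟩ := exists_eq_pow_of_isSquare_two_pow hf.isSquare
  have hz : zeta m ^ 2 ^ (m + 1) = 1 := by
    rw [pow_succ', zeta_pow_two_mul]
  let χ : Multiplicative (ZMod (2 ^ (m + 1))) × Multiplicative (ZMod 2) →*
      TwoPowCyclotomicRing m :=
    (AddChar.zmodChar (2 ^ (m + 1)) hz).toMonoidHom.comp (MonoidHom.fst _ _)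
  have hχ : ∀ g, χ g = zeta m ^ (g.1.toAdd).val := fun _ => rfl
  have hprod := hf.sum_mul_sum χ ((conj m : _ →* _).comp χ) fun g => by
    change χ g * conj m (χ g) = 1
    rw [hχ, conj_zeta_pow]
  set F : TwoPowCyclotomicRing m := ∑ g, (f g : TwoPowCyclotomicRing m) * χ g with hF
  have hFF : F * conj m F = 2 ^ (2 * a) := by
    rw [← ha, hF, map_sum, ← hF]
    convert hprod using 2
    · simp
    · push_cast
      rfl
  let A : ℕ → ℤ := fun j =>
    ∑ c : Multiplicative (ZMod 2), f (Multiplicative.ofAdd (j : ZMod (2 ^ (m + 1))), c)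
  have hA : ∀ j, |A j| ≤ 2 := fun j => by
    refine (Finset.abs_sum_le_sum_abs _ _).trans ((Finset.sum_le_sum fun c _ => hsign _).trans ?_)
    simp
  -- Fold the upper half of the exponents onto the lower half by `ζ^(2^m) = -1`.
  have hFA : F = ∑ j ∈ Finset.range (2 ^ m), ((A j - A (2 ^ m + j) : ℤ) : TwoPowCyclotomicRing m) *
      zeta m ^ j := by
    have h1 : F =
        ∑ j ∈ Finset.range (2 ^ (m + 1)), (A j : TwoPowCyclotomicRing m) * zeta m ^ j := by
      rw [hF, Fintype.sum_prod_type]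
      refine Finset.sum_nbij' (fun x => x.toAdd.val)
        (fun j => Multiplicative.ofAdd (j : ZMod (2 ^ (m + 1)))) (fun x _ => ?_) (fun j _ => ?_)
        (fun x _ => ?_) (fun j hj => ?_) (fun x _ => ?_)
      · exact Finset.mem_range.mpr (ZMod.val_lt _)
      · exact Finset.mem_univ _
      · simp
      · simpa using Nat.mod_eq_of_lt (Finset.mem_range.mp hj)
      · rw [Int.cast_sum, Finset.sum_mul]
        refine Finset.sum_congr rfl fun c _ => ?_
        rw [hχ]
        simp
    rw [h1, pow_succ, mul_two, Finset.sum_range_add, ← Finset.sum_add_distrib]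
    refine Finset.sum_congr rfl fun j _ => ?_
    rw [pow_add, zeta_pow]
    push_cast
    ring
  have hdvd := two_pow_dvd_of_mul_conj_eq a F hFF
  have hne : ∃ j < 2 ^ m, A j - A (2 ^ m + j) ≠ 0 := by
    by_contra! hall
    have h0 : F = 0 := by
      rw [hFA]
      refine Finset.sum_eq_zero fun j hj => ?_
      rw [hall j (Finset.mem_range.mp hj)]
      simp
    rw [h0, zero_mul] at hFF
    exact pow_ne_zero _ two_ne_zero' hFF.symm
  obtain ⟨j, hj, hj0⟩ := hne
  have hdj : ((2 ^ a : ℕ) : ℤ) ∣ A j - A (2 ^ m + j) :=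
    dvd_coeff_of_dvd_sum (m := m) _ (fun j => A j - A (2 ^ m + j)) (by
      rw [← hFA]
      exact_mod_cast hdvd) j hj
  have hle : ((2 ^ a : ℕ) : ℤ) ≤ 4 := by
    refine (Int.le_of_dvd (abs_pos.mpr hj0) ((dvd_abs _ _).mpr hdj)).trans ?_
    have := abs_sub (A j) (A (2 ^ m + j))
    have := hA j
    have := hA (2 ^ m + j)
    linarith
  have ha2 : a ≤ 2 := by
    have : 2 ^ a ≤ 2 ^ 2 := by exact_mod_cast hle
    exact (Nat.pow_le_pow_iff_right (by norm_num)).mp this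
  -- From `m + 2 = 2a` and `a ≤ 2`.
  omega

/-! ### From Hadamard codes to perfect functions. -/

/-- The sign `(-1)^a` of a bit. -/
def bitSign (a : ZMod 2) : ℤ := if a = 0 then 1 else -1

theorem bitSign_add : ∀ a b : ZMod 2, bitSign (a + b) = bitSign a * bitSign b := by decide

theorem bitSign_mul_self : ∀ a : ZMod 2, bitSign a * bitSign a = 1 := by decide

theorem abs_bitSign_le_one : ∀ a : ZMod 2, |bitSign a| ≤ 1 := by decide

theorem add_self_eq_zero_of_zmod_two {n : ℕ} (x : Fin n → ZMod 2) : x + x = 0 :=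
  funext fun i => CharTwo.add_self_eq_zero (x i)

theorem bitSign_binaryRow {n : ℕ} {H : Matrix (Fin n) (Fin n) ℤ} (hH : H.IsHadamard)
    (i k : Fin n) : bitSign (binaryRow H i k) = H i k := by
  have h : H i k * H i k = 1 := by simpa using (Unitary.mem_iff.mp (hH.apply_mem i k)).1
  rcases mul_self_eq_one_iff.mp h with h | h <;> simp [binaryRow, bitSign, h]

/-- Every word of a Hadamard code other than `0` and the all-one word is balanced. -/
theorem IsHadamardCode.sum_bitSign_eq_zero {n : ℕ} {C : Set (Fin n → ZMod 2)}
    (hC : IsHadamardCode C) {x : Fin n → ZMod 2} (hx : x ∈ C) (h0 : x ≠ 0)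
    (h1 : x ≠ allOnes n) : ∑ k, bitSign (x k) = 0 := by
  obtain ⟨h0C, H, hH, rfl⟩ := hC
  -- A row giving `0` gives only `0` and `u`, so `x` comes from a different row, orthogonal to it.
  have key : ∀ y z : Fin n → ZMod 2, ∀ i, (y = binaryRow H i ∨ y = binaryRow H i + allOnes n) →
      (z = binaryRow H i ∨ z = binaryRow H i + allOnes n) → z = 0 → y = 0 ∨ y = allOnes n := by
    intro y z i hy hz hz0
    subst hz0
    have hrow : binaryRow H i = 0 ∨ binaryRow H i = allOnes n := by
      rcases hz with hz | hz
      · exact Or.inl hz.symm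
      · right
        have := congrArg (· + allOnes n) hz
        simpa [add_assoc, add_self_eq_zero_of_zmod_two] using this.symm
    rcases hy with rfl | rfl <;> rcases hrow with h | h <;>
      simp [h, add_self_eq_zero_of_zmod_two]
  have sign : ∀ y i, (y = binaryRow H i ∨ y = binaryRow H i + allOnes n) →
      ∃ s : ℤ, ∀ k, bitSign (y k) = s * H i k := by
    rintro y i (rfl | rfl)
    · exact ⟨1, fun k => by rw [bitSign_binaryRow hH, one_mul]⟩
    · refine ⟨-1, fun k => ?_⟩
      rw [Pi.add_apply, bitSign_add, bitSign_binaryRow hH, mul_comm]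
      rfl
  obtain ⟨i, hi⟩ := hx
  obtain ⟨j, hj⟩ := h0C
  have hij : i ≠ j := by
    rintro rfl
    exact (key x 0 i hi hj rfl).elim h0 h1
  have horth : ∑ k, H i k * H j k = 0 := by
    have := congrFun (congrFun hH.mul_conjTranspose i) j
    simpa [Matrix.mul_apply, Matrix.one_apply, hij] using this
  obtain ⟨s, hs⟩ := sign x i hi
  obtain ⟨r, hr⟩ := sign 0 j hj
  calc ∑ k, bitSign (x k) = ∑ k, bitSign (x k) * bitSign ((0 : Fin n → ZMod 2) k) := by
        simp [bitSign]
    _ = s * r * ∑ k, H i k * H j k := by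
        rw [Finset.mul_sum]
        exact Finset.sum_congr rfl fun k _ => by rw [hs, hr]; ring
    _ = 0 := by rw [horth, mul_zero]

namespace PropelinearStructure

/-- A group `G` of order `n` embedded in a Hadamard full propelinear code of length `n` so as to
avoid the all-one word acts regularly on the coordinates, and any coordinate function restricted to
it is perfect. -/
theorem IsHFP.isPerfect {n : ℕ} {C : Set (Fin n → ZMod 2)} {S : PropelinearStructure C}
    (hS : S.IsHFP) {G : Type*} [Group G] [Fintype G] (hcard : Fintype.card G = n)
    (w : G →* S.Word) (hinj : Function.Injective w) (hu : ∀ g, (w g).1 ≠ allOnes n) (i : Fin n) :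
    IsPerfect n fun g => bitSign ((w g).1 i) := by
  have hne : ∀ g, g ≠ 1 → (w g).1 ≠ 0 := fun g hg h =>
    hg (hinj ((Subtype.ext h : w g = 1).trans (map_one w).symm))
  have hperm : ∀ g h, S.perm (w (g * h)) = S.perm (w g) * S.perm (w h) := fun g h => by
    rw [map_mul]
    exact S.perm_word_mul _ _
  have hone : S.perm (w 1) = 1 := hS.2.1 _ (Or.inl (by rw [map_one]; rfl))
  have hinv : ∀ g, (S.perm (w g))⁻¹ = S.perm (w g⁻¹) := fun g => by
    rw [inv_eq_iff_mul_eq_one, ← hperm, mul_inv_cancel, hone]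
  have hval : ∀ h g, (w (h * g)).1 i = (w h).1 i + (w g).1 (S.perm (w h⁻¹) i) := fun h g => by
    rw [← hinv, map_mul]
    rfl
  -- If `g` and `h` agree here, `g * h⁻¹` fixes `i`, contradicting fullness.
  have horbit : Function.Bijective fun g : G => S.perm (w g⁻¹) i := by
    rw [Fintype.bijective_iff_injective_and_card]
    refine ⟨fun g h hgh => ?_, by simpa using hcard⟩
    by_contra hne'
    have hgh1 : g * h⁻¹ ≠ 1 := fun h' => hne' (mul_inv_eq_one.mp h')
    refine hS.2.2 (w (g * h⁻¹)) (hne _ hgh1) (hu _) i ?_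
    rw [hperm, Equiv.Perm.mul_apply, ← show S.perm (w g⁻¹) i = S.perm (w h⁻¹) i from hgh,
      ← Equiv.Perm.mul_apply, ← hperm, mul_inv_cancel, hone, Equiv.Perm.one_apply]
  refine ⟨?_, fun g hg => ?_⟩
  · simp [bitSign_mul_self, hcard]
  -- By regularity, the autocorrelation at `g` is the sign sum of `w g` over all coordinates.
  · rw [← hS.1.sum_bitSign_eq_zero (w g).2 (hne g hg) (hu g),
      ← Equiv.sum_comp (Equiv.ofBijective _ horbit)]
    refine Finset.sum_congr rfl fun h _ => ?_
    change bitSign ((w (h * g)).1 i) * bitSign ((w h).1 i) =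
      bitSign ((w g).1 (S.perm (w h⁻¹) i))
    rw [hval, bitSign_add, mul_right_comm, bitSign_mul_self, one_mul]

end PropelinearStructure

theorem mainTheorem10 (t : ℕ) (ht : ∃ m : ℕ, t = 2 ^ m)
    (C : Set (Fin (4 * t) → ZMod 2)) (S : PropelinearStructure C)
    (hC : S.IsHFPOfType22u (2 * t)) :
    t = 1 ∨ t = 4 := by
  obtain ⟨m, rfl⟩ := ht
  obtain ⟨hS, hφ⟩ := hC
  have hm : 2 * 2 ^ m = 2 ^ (m + 1) := (pow_succ' 2 m).symm
  rw [hm] at hφ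
  obtain ⟨φ, u, hu, hφ⟩ := hφ
  let w : Multiplicative (ZMod (2 ^ (m + 1))) × Multiplicative (ZMod 2) →* S.Word :=
    φ.symm.toMonoidHom.comp
      ((MonoidHom.fst _ _).prod ((MonoidHom.snd _ _).prod (1 : _ →* Multiplicative (ZMod 2))))
  have hφw : ∀ g, φ (w g) = (g.1, g.2, 1) := fun g => φ.apply_symm_apply _
  have hinj : Function.Injective w := fun g h hgh => by
    have := congrArg φ hgh
    rw [hφw, hφw] at this
    simpa [Prod.ext_iff] using this
  have hwu : ∀ g, (w g).1 ≠ allOnes (4 * 2 ^ m) := fun g hg => by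
    have h1 : w g = u := Subtype.ext (hg.trans hu.symm)
    have h2 := hφw g
    rw [h1, hφ] at h2
    simp [Prod.ext_iff] at h2
  have hperf := hS.isPerfect (by simp [ZMod.card]; ring) w hinj hwu ⟨0, by positivity⟩
  have hn : ((4 * 2 ^ m : ℕ) : ℤ) = 2 ^ (m + 2) := by
    push_cast
    ring
  rw [hn] at hperf
  rcases hperf.exponent_bound fun g => abs_bitSign_le_one _ with rfl | rfl <;> norm_num
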